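/- Let $n>h\ge 1$ be integers and put $r=\frac{h}{\gcd(n,h)}$. Let $K_n^h=(V,\binom{V}{h})$ be the complete $h$-uniform hypergraph on a vertex set $V$ with $|V|=n$; its edges are all $h$-subsets of $V$, each taken once. An $r$-factor is a sub-hypergraph with the whole vertex set $V$ in which every vertex has degree $r$, and an $r$-factorization is a partition of the edge set into $r$-factors; it is connected if each of its factors is a connected hypergraph, that is, any two vertices are joined by a finite chain of vertices in which consecutive ones lie in a common edge. Then $K_n^h$ has an $r$-factorization. If moreover $h\nmid n$ (equivalently, $r\ge 2$), then $K_n^h$ has a connected $r$-factorization. -/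

import Mathlib

/-- A hypergraph: a finite vertex set together with a multiset of edges, each edge being a
multi-subset of the vertex set.  (Edges may be repeated, and a vertex may occur several times
within an edge.) -/
structure MultiHypergraph (α : Type*) where
  /-- The vertex set. -/
  vertices : Finset α
  /-- The multiset of edges. -/
  edges : Multiset (Multiset α)
  /-- Every edge is a multi-subset of the vertex set. -/
  mem_vertices : ∀ e ∈ edges, ∀ v ∈ e, v ∈ vertices

namespace MultiHypergraph

variable {α : Type*}

/-- The degree of `v`: the total number of occurrences of `v` among all edges. -/
def degree [DecidableEq α] (G : MultiHypergraph α) (v : α) : ℕ :=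
  (G.edges.map (fun e => e.count v)).sum

/-- `G` is `r`-regular: every vertex has degree `r`. -/
def IsRegular [DecidableEq α] (G : MultiHypergraph α) (r : ℕ) : Prop :=
  ∀ v ∈ G.vertices, G.degree v = r

/-- Two vertices are adjacent if some edge contains both. -/
def Adj (G : MultiHypergraph α) (u v : α) : Prop :=
  ∃ e ∈ G.edges, u ∈ e ∧ v ∈ e

/-- `G` is connected: it has a vertex, and any two vertices are joined by a finite chain of
vertices in which consecutive ones lie in a common edge. -/
def IsConnected (G : MultiHypergraph α) : Prop :=
  G.vertices.Nonempty ∧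
    ∀ u ∈ G.vertices, ∀ v ∈ G.vertices, Relation.ReflTransGen G.Adj u v

/-- `F` is an `r`-factor of `G`: a spanning `r`-regular sub-hypergraph. -/
def IsFactor [DecidableEq α] (G : MultiHypergraph α) (r : ℕ) (F : MultiHypergraph α) : Prop :=
  F.vertices = G.vertices ∧ F.edges ≤ G.edges ∧ F.IsRegular r

/-- `F 0, …, F (k - 1)` is an `(r 0, …, r (k - 1))`-factorization of `G`: the `r i` are positive,
`F i` is an `r i`-factor of `G`, and the edge multisets of the `F i` partition that of `G`. -/
def IsFactorization [DecidableEq α] (G : MultiHypergraph α) {k : ℕ} (r : Fin k → ℕ)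
    (F : Fin k → MultiHypergraph α) : Prop :=
  (∀ i, 0 < r i) ∧ (∀ i, G.IsFactor (r i) (F i)) ∧ ∑ i, (F i).edges = G.edges

/-- `G` has an `r`-factorization, i.e. an `(r, …, r)`-factorization. -/
def HasFactorization [DecidableEq α] (G : MultiHypergraph α) (r : ℕ) : Prop :=
  ∃ (k : ℕ) (F : Fin k → MultiHypergraph α), G.IsFactorization (fun _ => r) F

/-- `G` has a connected `r`-factorization: an `r`-factorization in which each factor is a
connected hypergraph. -/
def HasConnectedFactorization [DecidableEq α] (G : MultiHypergraph α) (r : ℕ) : Prop :=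
  ∃ (k : ℕ) (F : Fin k → MultiHypergraph α),
    G.IsFactorization (fun _ => r) F ∧ ∀ i, (F i).IsConnected

/-- The complete `h`-uniform hypergraph on the vertex set `V`: its edges are the `h`-subsets
of `V`, each taken once. -/
def complete (V : Finset α) (h : ℕ) : MultiHypergraph α where
  vertices := V
  edges := (V.powersetCard h).val.map Finset.val
  mem_vertices := by
    intro e he v hv
    obtain ⟨s, hs, rfl⟩ := Multiset.mem_map.1 he
    exact (Finset.mem_powersetCard.1 hs).1 hv

end MultiHypergraph

/-! This is Baranyai's theorem, proved by adding the vertices one at a time. The future edges are `k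
* m` items, coloured by `k` factors of `m = n / gcd(n, h)` items each; `exists_mul_eq_choose` makes
the numbers fit. Each item has a trace on the set `T` of vertices added so far. With `N` vertices
missing, every `A ⊆ T` with at most `h` elements is the trace of `N.choose (h - |A|)` items, and
each vertex of `T` has degree `r` in each colour. For `N = 0` this is an `r`-factorization of the
complete hypergraph.

The items that receive the next vertex are found by rounding the weights `(h - |S j|) / N` to 0 or
1. These weights add up to exactly `r` over a colour and to exactly `(N - 1).choose (h - |A| - 1)`
over the items with trace `A`, so a rounding with error below one on these classes is exact there.
Colours and traces form two independent partitions; the rounding is an integral circulation near a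
rational one (`exists_integral_circulation`), and the network can also control a chain of
refinements of the colours.

Connectivity uses that freedom. Each colour is divided into labels whose items are already chained
together. The invariant is that a colour has at most `(r - 1) * N + 1` labels and that, while `N >
0`, every label still has a missing incidence. The rounding is balanced on labels, and on the union
of the labels of a colour with at least two missing incidences. All labels of a colour that receive
the new vertex are then merged; `one_le_sum_mergeLabel` and `card_mergeLabel_add_le` preserve the
invariant. At `N = 0` one label per colour remains. The condition `r ≥ 2` is what makes the
invariant true at the start. -/

/-! ### Rounding rational circulations -/

/-- Some circulation is supported on the non-integral arcs of a given circulation. -/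
theorem exists_ne_zero_circulation_of_fract {E N : Type*} [Fintype E] [Fintype N] [DecidableEq N]
    (s t : E → N) (x : E → ℚ)
    (hx : ∀ n, ∑ e, (if s e = n then x e else 0) = ∑ e, (if t e = n then x e else 0))
    (hfrac : ∃ e, Int.fract (x e) ≠ 0) :
    ∃ δ : E → ℚ, (∀ e, Int.fract (x e) = 0 → δ e = 0) ∧ (∃ e, δ e ≠ 0) ∧
      ∀ n, ∑ e, (if s e = n then δ e else 0) = ∑ e, (if t e = n then δ e else 0) := by
  classical
  obtain ⟨e₀, he₀⟩ := hfrac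
  set F : Finset E := Finset.univ.filter fun e => Int.fract (x e) ≠ 0 with hF
  set M : Finset N := F.image s ∪ F.image t with hM
  have heF : e₀ ∈ F := by simp [hF, he₀]
  -- If a node met only one non-integral arc, conservation there would write that arc's value as an
  -- integer. A loop counts twice. Double counting then gives `M.card ≤ F.card`.
  have hdeg : ∀ n ∈ M, 2 ≤ ∑ e ∈ F, ((if s e = n then 1 else 0) + (if t e = n then 1 else 0)) := by
    intro n hn
    by_contra hlt
    obtain ⟨e, he, hen⟩ : ∃ e ∈ F, s e = n ∨ t e = n := by
      simp only [hM, Finset.mem_union, Finset.mem_image] at hn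
      rcases hn with ⟨e, he, h⟩ | ⟨e, he, h⟩
      · exact ⟨e, he, Or.inl h⟩
      · exact ⟨e, he, Or.inr h⟩
    rw [← Finset.add_sum_erase F _ he] at hlt
    have hone : 1 ≤ (if s e = n then 1 else 0) + (if t e = n then 1 else 0) := by
      rcases hen with h | h <;> simp [h]
    have hrest : ∑ e ∈ F.erase e, ((if s e = n then 1 else 0) + (if t e = n then 1 else 0)) = 0 := by
      omega
    have hle : (if s e = n then 1 else 0) + (if t e = n then 1 else 0) ≤ 1 := by omega
    rw [Finset.sum_eq_zero_iff] at hrest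
    have hz : ∑ e', ((if s e' = n then x e' else 0) - (if t e' = n then x e' else 0)) = 0 := by
      rw [Finset.sum_sub_distrib, hx n, sub_self]
    rw [← Finset.add_sum_erase Finset.univ _ (Finset.mem_univ e)] at hz
    have hint : ∑ e' ∈ Finset.univ.erase e,
        ((if s e' = n then x e' else 0) - (if t e' = n then x e' else 0)) ∈
        (Int.castAddHom ℚ).range := by
      refine AddSubgroup.sum_mem _ fun e' he' => ?_
      by_cases h : e' ∈ F
      · have := hrest e' (Finset.mem_erase.2 ⟨(Finset.mem_erase.1 he').1, h⟩)
        have h1 : s e' ≠ n := by intro h'; simp [h'] at this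
        have h2 : t e' ≠ n := by intro h'; simp [h'] at this
        simp [h1, h2]
      · have hfr : Int.fract (x e') = 0 := by simpa [hF] using h
        have hmem : x e' ∈ (Int.castAddHom ℚ).range := by
          obtain ⟨z, hz⟩ := Int.fract_eq_zero_iff.1 hfr
          exact ⟨z, hz⟩
        refine AddSubgroup.sub_mem _ ?_ ?_ <;> split_ifs <;>
          first | exact hmem | exact AddSubgroup.zero_mem _
    obtain ⟨z, hz'⟩ := hint
    rw [← hz'] at hz
    have hxe : Int.fract (x e) ≠ 0 := by simpa [hF] using he
    apply hxe
    rw [Int.fract_eq_zero_iff]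
    simp only [Int.coe_castAddHom] at hz
    by_cases h1 : s e = n <;> by_cases h2 : t e = n
    · simp [h1, h2] at hle
    · exact ⟨-z, by simp [h1, h2] at hz; push_cast; linarith⟩
    · exact ⟨z, by simp [h1, h2] at hz; linarith⟩
    · simp [h1, h2] at hone
  have hcard : M.card ≤ F.card := by
    have h1 : ∑ n ∈ M, 2 ≤ ∑ n ∈ M, ∑ e ∈ F,
        ((if s e = n then 1 else 0) + (if t e = n then 1 else 0)) := Finset.sum_le_sum hdeg
    rw [Finset.sum_comm] at h1
    have h2 : ∀ e ∈ F, ∑ n ∈ M, ((if s e = n then 1 else 0) + (if t e = n then 1 else 0)) ≤ 2 := by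
      intro e _
      rw [Finset.sum_add_distrib, Finset.sum_ite_eq, Finset.sum_ite_eq]
      split_ifs <;> simp
    have h3 := Finset.sum_le_sum h2
    simp only [Finset.sum_const, smul_eq_mul] at h1 h3
    omega
  have hsM : s e₀ ∈ M := Finset.mem_union_left _ (Finset.mem_image_of_mem _ heF)
  -- The net outflows over all nodes sum to zero, so the equation at one node is redundant. Dropping
  -- it leaves fewer equations than unknowns.
  let L : (F → ℚ) →ₗ[ℚ] (M.erase (s e₀) → ℚ) :=
    { toFun := fun δ n => ∑ e : F, ((if s e = n then δ e else 0) - (if t e = n then δ e else 0))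
      map_add' := by
        intro a b
        ext n
        simp only [Pi.add_apply]
        rw [← Finset.sum_add_distrib]
        refine Finset.sum_congr rfl fun e _ => ?_
        split_ifs <;> ring
      map_smul' := by
        intro c a
        ext n
        simp only [Pi.smul_apply, smul_eq_mul, RingHom.id_apply]
        rw [Finset.mul_sum]
        refine Finset.sum_congr rfl fun e _ => ?_
        split_ifs <;> ring }
  have hker : LinearMap.ker L ≠ ⊥ := by
    apply LinearMap.ker_ne_bot_of_finrank_lt
    rw [Module.finrank_fintype_fun_eq_card, Module.finrank_fintype_fun_eq_card,
      Fintype.card_coe, Fintype.card_coe, Finset.card_erase_of_mem hsM]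
    have : 0 < M.card := Finset.card_pos.2 ⟨_, hsM⟩
    omega
  obtain ⟨δ, hδ, hδ0⟩ := (Submodule.ne_bot_iff _).1 hker
  have hne : ∃ e, δ e ≠ 0 := by
    by_contra hcon
    push Not at hcon
    exact hδ0 (funext hcon)
  obtain ⟨⟨e₁, he₁⟩, hδe⟩ := hne
  let ε : E → ℚ := fun e => if h : e ∈ F then δ ⟨e, h⟩ else 0
  have hsum : ∀ n, ∑ e, ((if s e = n then ε e else 0) - (if t e = n then ε e else 0)) =
      ∑ e : F, ((if s e = n then δ e else 0) - (if t e = n then δ e else 0)) := by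
    intro n
    rw [← Finset.sum_subset (Finset.subset_univ F), ← Finset.sum_coe_sort]
    · refine Finset.sum_congr rfl fun e _ => ?_
      simp [ε]
    · intro e _ he
      simp [ε, he]
  have hoff : ∀ n, n ≠ s e₀ →
      ∑ e, ((if s e = n then ε e else 0) - (if t e = n then ε e else 0)) = 0 := by
    intro n hn
    rw [hsum]
    by_cases hnM : n ∈ M
    · exact congrFun (LinearMap.mem_ker.1 hδ) ⟨n, Finset.mem_erase.2 ⟨hn, hnM⟩⟩
    · refine Finset.sum_eq_zero fun e _ => ?_
      have h1 : s e ≠ n := by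
        rintro rfl
        exact hnM (Finset.mem_union_left _ (Finset.mem_image_of_mem _ e.2))
      have h2 : t e ≠ n := by
        rintro rfl
        exact hnM (Finset.mem_union_right _ (Finset.mem_image_of_mem _ e.2))
      simp [h1, h2]
  have htot : ∑ n, ∑ e, ((if s e = n then ε e else 0) - (if t e = n then ε e else 0)) = 0 := by
    rw [Finset.sum_comm]
    refine Finset.sum_eq_zero fun e _ => ?_
    simp [Finset.sum_sub_distrib]
  refine ⟨ε, fun e he => ?_, ⟨e₁, by simpa [ε, he₁] using hδe⟩, fun n => ?_⟩
  · have : e ∉ F := by simp [hF, he]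
    simp [ε, this]
  · rw [← sub_eq_zero, ← Finset.sum_sub_distrib]
    by_cases hn : n = s e₀
    · subst hn
      rwa [Finset.sum_eq_single (s e₀) (fun n _ hn => hoff n hn) (by simp)] at htot
    · exact hoff n hn

/-- Every rational circulation can be rounded to an integral one. -/
theorem exists_integral_circulation {E N : Type*} [Fintype E] [Fintype N] [DecidableEq N]
    (s t : E → N) (x : E → ℚ)
    (hx : ∀ n, ∑ e, (if s e = n then x e else 0) = ∑ e, (if t e = n then x e else 0)) :
    ∃ y : E → ℤ,
      (∀ n, ∑ e, (if s e = n then y e else 0) = ∑ e, (if t e = n then y e else 0)) ∧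
      ∀ e, ⌊x e⌋ ≤ y e ∧ y e ≤ ⌈x e⌉ := by
  classical
  induction hk : (Finset.univ.filter fun e => Int.fract (x e) ≠ 0).card
    using Nat.strong_induction_on generalizing x with
  | _ k ih =>
  by_cases hfrac : ∃ e, Int.fract (x e) ≠ 0
  · obtain ⟨δ, hδ0, ⟨e₁, he₁⟩, hδ⟩ := exists_ne_zero_circulation_of_fract s t x hx hfrac
    -- The multiple of `δ` at which arc `e` reaches its ceiling or floor. Moving by the least such
    -- multiple makes `e₂` integral and keeps every arc between its old floor and ceiling.
    let lim : E → ℚ := fun e => if 0 < δ e then (⌈x e⌉ - x e) / δ e else (⌊x e⌋ - x e) / δ e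
    obtain ⟨e₂, he₂, hmin⟩ := Finset.exists_min_image (Finset.univ.filter fun e => δ e ≠ 0) lim
      ⟨e₁, by simpa using he₁⟩
    have he₂' : δ e₂ ≠ 0 := by simpa using he₂
    have hlim : ∀ e, 0 ≤ lim e := by
      intro e
      simp only [lim]
      split_ifs with h
      · exact div_nonneg (sub_nonneg.2 (Int.le_ceil _)) h.le
      · exact div_nonneg_of_nonpos (sub_nonpos.2 (Int.floor_le _)) (not_lt.1 h)
    set c := lim e₂ with hc
    have hbound : ∀ e, (⌊x e⌋ : ℚ) ≤ x e + c * δ e ∧ x e + c * δ e ≤ ⌈x e⌉ := by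
      intro e
      have h0 : 0 ≤ c := hlim e₂
      have hfl := Int.floor_le (x e)
      have hce := Int.le_ceil (x e)
      rcases lt_trichotomy (δ e) 0 with h | h | h
      · have h1 : c ≤ lim e := hmin e (by simpa using h.ne)
        simp only [lim, not_lt.2 h.le, if_false] at h1
        rw [le_div_iff_of_neg h] at h1
        constructor <;> nlinarith
      · rw [h]; constructor <;> simpa
      · have h1 : c ≤ lim e := hmin e (by simpa using h.ne')
        simp only [lim, h, if_true] at h1
        rw [le_div_iff₀ h] at h1
        constructor <;> nlinarith
    have hfr₂ : Int.fract (x e₂) ≠ 0 := fun h => he₂' (hδ0 e₂ h)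
    have hint : Int.fract (x e₂ + c * δ e₂) = 0 := by
      rw [Int.fract_eq_zero_iff]
      simp only [hc, lim]
      split_ifs
      · exact ⟨⌈x e₂⌉, by rw [div_mul_cancel₀ _ he₂']; ring⟩
      · exact ⟨⌊x e₂⌋, by rw [div_mul_cancel₀ _ he₂']; ring⟩
    have hlt : (Finset.univ.filter fun e => Int.fract (x e + c * δ e) ≠ 0).card < k := by
      rw [← hk]
      refine Finset.card_lt_card ((Finset.ssubset_iff_of_subset ?_).2 ⟨e₂, ?_, ?_⟩)
      · intro e he
        simp only [Finset.mem_filter, Finset.mem_univ, true_and] at he ⊢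
        intro h
        rw [hδ0 e h, mul_zero, add_zero] at he
        exact he h
      · simpa using hfr₂
      · simpa using hint
    have hcirc : ∀ n, ∑ e, (if s e = n then x e + c * δ e else 0) =
        ∑ e, (if t e = n then x e + c * δ e else 0) := by
      intro n
      have key : ∀ u : E → N, ∑ e, (if u e = n then x e + c * δ e else 0) =
          ∑ e, (if u e = n then x e else 0) + c * ∑ e, (if u e = n then δ e else 0) := by
        intro u
        rw [Finset.mul_sum, ← Finset.sum_add_distrib]
        refine Finset.sum_congr rfl fun e _ => ?_
        split_ifs <;> simp
      rw [key, key, hx, hδ]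
    obtain ⟨y, hy, hy'⟩ := ih _ hlt (fun e => x e + c * δ e) hcirc rfl
    refine ⟨y, hy, fun e => ⟨?_, ?_⟩⟩
    · exact (Int.le_floor.2 (hbound e).1).trans (hy' e).1
    · exact (hy' e).2.trans (Int.ceil_le.2 (hbound e).2)
  · push Not at hfrac
    have hfl : ∀ e, ((⌊x e⌋ : ℤ) : ℚ) = x e := fun e => by
      have := Int.floor_add_fract (x e)
      rwa [hfrac e, add_zero] at this
    refine ⟨fun e => ⌊x e⌋, fun n => ?_, fun e => ⟨le_rfl, Int.floor_le_ceil _⟩⟩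
    have key : ∀ u : E → N, ((∑ e, (if u e = n then ⌊x e⌋ else 0) : ℤ) : ℚ) =
        ∑ e, (if u e = n then x e else 0) := by
      intro u
      rw [Int.cast_sum]
      refine Finset.sum_congr rfl fun e _ => ?_
      split_ifs
      · exact hfl e
      · simp
    have := hx n
    rw [← key, ← key] at this
    exact_mod_cast this

/-! ### Rounding on nested partitions and one further partition -/

theorem sum_ite_sum_fiber {J A B M : Type*} [Fintype J] [Fintype A] [DecidableEq A]
    [DecidableEq B] [AddCommMonoid M] (f : J → A) (p : A → B) (x : J → M) (b : B) :
    ∑ a, (if p a = b then ∑ j with f j = a, x j else 0) = ∑ j with p (f j) = b, x j := by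
  rw [Finset.sum_filter, ← Finset.sum_fiberwise Finset.univ f]
  refine Finset.sum_congr rfl fun a _ => ?_
  split_ifs with h
  · refine Finset.sum_congr rfl fun j hj => ?_
    rw [(Finset.mem_filter.1 hj).2, if_pos h]
  · refine (Finset.sum_eq_zero fun j hj => ?_).symm
    rw [(Finset.mem_filter.1 hj).2, if_neg h]

/-- Simultaneous rounding along a chain of nested partitions and one further partition. -/
theorem exists_rounding {J A B C D : Type*} [Fintype J] [Fintype A] [Fintype B] [Fintype C]
    [Fintype D] [DecidableEq A] [DecidableEq B] [DecidableEq C] [DecidableEq D]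
    (f : J → A) (p : A → B) (q : B → C) (g : J → D) (x : J → ℚ) :
    ∃ y : J → ℤ, (∀ j, |(y j : ℚ) - x j| < 1) ∧
      (∀ a, |∑ j with f j = a, (y j : ℚ) - ∑ j with f j = a, x j| < 1) ∧
      (∀ b, |∑ j with p (f j) = b, (y j : ℚ) - ∑ j with p (f j) = b, x j| < 1) ∧
      (∀ c, |∑ j with q (p (f j)) = c, (y j : ℚ) - ∑ j with q (p (f j)) = c, x j| < 1) ∧
      (∀ d, |∑ j with g j = d, (y j : ℚ) - ∑ j with g j = d, x j| < 1) := by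
  classical
  have near : ∀ (a : ℚ) (z : ℤ), ⌊a⌋ ≤ z ∧ z ≤ ⌈a⌉ → |(z : ℚ) - a| < 1 := by
    intro a z ⟨h1, h2⟩
    have h1' : (⌊a⌋ : ℚ) ≤ z := by exact_mod_cast h1
    have h2' : (z : ℚ) ≤ ⌈a⌉ := by exact_mod_cast h2
    rw [abs_lt]
    constructor
    · linarith [Int.lt_floor_add_one a]
    · linarith [Int.ceil_lt_add_one a]
  -- The network runs root → `C` → `B` → `A` → `D` → root. Item `j` is the arc from `f j` to `g j`,
  -- and every other arc carries the sum over one fiber.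
  let s : J ⊕ A ⊕ B ⊕ C ⊕ D → A ⊕ B ⊕ C ⊕ D ⊕ Unit :=
    Sum.elim (fun j => .inl (f j)) <| Sum.elim (fun a => .inr (.inl (p a))) <|
      Sum.elim (fun b => .inr (.inr (.inl (q b)))) <|
      Sum.elim (fun _ => .inr (.inr (.inr (.inr ())))) fun d => .inr (.inr (.inr (.inl d)))
  let t : J ⊕ A ⊕ B ⊕ C ⊕ D → A ⊕ B ⊕ C ⊕ D ⊕ Unit :=
    Sum.elim (fun j => .inr (.inr (.inr (.inl (g j))))) <| Sum.elim (fun a => .inl a) <|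
      Sum.elim (fun b => .inr (.inl b)) <|
      Sum.elim (fun c => .inr (.inr (.inl c))) fun _ => .inr (.inr (.inr (.inr ())))
  let X : J ⊕ A ⊕ B ⊕ C ⊕ D → ℚ :=
    Sum.elim x <| Sum.elim (fun a => ∑ j with f j = a, x j) <|
      Sum.elim (fun b => ∑ j with p (f j) = b, x j) <|
      Sum.elim (fun c => ∑ j with q (p (f j)) = c, x j) fun d => ∑ j with g j = d, x j
  have total : ∑ c, ∑ j with q (p (f j)) = c, x j = ∑ d, ∑ j with g j = d, x j := by
    rw [Finset.sum_fiberwise, Finset.sum_fiberwise]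
  obtain ⟨y, hy, hyX⟩ := exists_integral_circulation s t X (by
    rintro (a | b | c | d | u)
    · simp [s, t, X, Finset.sum_filter]
    · simp [s, t, X, sum_ite_sum_fiber]
    · simp [s, t, X, sum_ite_sum_fiber (fun j => p (f j))]
    · simp [s, t, X, Finset.sum_filter]
    · simpa [s, t, X] using total)
  have hA : ∀ a, y (.inr (.inl a)) = ∑ j with f j = a, y (.inl j) := fun a => by
    simpa [s, t, Finset.sum_filter] using (hy (.inl a)).symm
  have hB : ∀ b, y (.inr (.inr (.inl b))) = ∑ j with p (f j) = b, y (.inl j) := fun b => by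
    have := (hy (.inr (.inl b))).symm
    simpa [s, t, hA, sum_ite_sum_fiber] using this
  have hC : ∀ c, y (.inr (.inr (.inr (.inl c)))) = ∑ j with q (p (f j)) = c, y (.inl j) :=
    fun c => by
    have := (hy (.inr (.inr (.inl c)))).symm
    simpa [s, t, hB, sum_ite_sum_fiber (fun j => p (f j))] using this
  have hD : ∀ d, y (.inr (.inr (.inr (.inr d)))) = ∑ j with g j = d, y (.inl j) := fun d => by
    simpa [s, t, Finset.sum_filter] using hy (.inr (.inr (.inr (.inl d))))
  refine ⟨fun j => y (.inl j), fun j => near _ _ (hyX (.inl j)), fun a => ?_, fun b => ?_,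
    fun c => ?_, fun d => ?_⟩
  · have := near _ _ (hyX (.inr (.inl a)))
    rw [hA] at this
    exact_mod_cast this
  · have := near _ _ (hyX (.inr (.inr (.inl b))))
    rw [hB] at this
    exact_mod_cast this
  · have := near _ _ (hyX (.inr (.inr (.inr (.inl c)))))
    rw [hC] at this
    exact_mod_cast this
  · have := near _ _ (hyX (.inr (.inr (.inr (.inr d)))))
    rw [hD] at this
    exact_mod_cast this

/-- Rounding of the weights `d j / N`, stated in integers: the chosen set `Y` meets each fiber in
`⌊d / N⌋` or `⌈d / N⌉` items, where `d` is the total weight of the fiber. -/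
theorem exists_rounding_finset {J A B C D : Type*} [Fintype J] [Fintype A] [Fintype B] [Fintype C]
    [DecidableEq J] [DecidableEq A] [DecidableEq B] [DecidableEq C] [DecidableEq D]
    (f : J → A) (p : A → B) (q : B → C) (g : J → D) (d : J → ℕ) (N : ℕ) (hN : 0 < N)
    (hd : ∀ j, d j ≤ N) :
    ∃ Y : Finset J, (∀ j ∈ Y, 1 ≤ d j) ∧
      (∀ a, N * {j ∈ Y | f j = a}.card < ∑ j with f j = a, d j + N ∧
        ∑ j with f j = a, d j < N * {j ∈ Y | f j = a}.card + N) ∧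
      (∀ b, N * {j ∈ Y | p (f j) = b}.card < ∑ j with p (f j) = b, d j + N ∧
        ∑ j with p (f j) = b, d j < N * {j ∈ Y | p (f j) = b}.card + N) ∧
      (∀ c, N * {j ∈ Y | q (p (f j)) = c}.card < ∑ j with q (p (f j)) = c, d j + N ∧
        ∑ j with q (p (f j)) = c, d j < N * {j ∈ Y | q (p (f j)) = c}.card + N) ∧
      (∀ e, N * {j ∈ Y | g j = e}.card < ∑ j with g j = e, d j + N ∧
        ∑ j with g j = e, d j < N * {j ∈ Y | g j = e}.card + N) := by
  -- `D` need not be finite, so `g` is restricted to its range; fibers outside the range are empty.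
  obtain ⟨y, hy, hA, hB, hC, hD⟩ :=
    exists_rounding f p q (fun j => (⟨g j, j, rfl⟩ : Set.range g)) (fun j => (d j : ℚ) / N)
  have hN' : (0 : ℚ) < N := by exact_mod_cast hN
  have h01 : ∀ j, y j = if y j = 1 then 1 else 0 := by
    intro j
    have h := abs_lt.1 (hy j)
    have h0 : (0 : ℚ) ≤ d j / N := by positivity
    have h1 : (d j : ℚ) / N ≤ 1 := by
      rw [div_le_one hN']
      exact_mod_cast hd j
    have h2 : (-1 : ℚ) < y j := by linarith
    have h3 : (y j : ℚ) < 2 := by linarith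
    have h2' : -1 < y j := by exact_mod_cast h2
    have h3' : y j < 2 := by exact_mod_cast h3
    split_ifs <;> omega
  have near : ∀ (P : J → Prop) [DecidablePred P],
      |∑ j with P j, (y j : ℚ) - ∑ j with P j, (d j : ℚ) / N| < 1 →
      N * {j ∈ Finset.univ.filter (fun j => y j = 1) | P j}.card < ∑ j with P j, d j + N ∧
        ∑ j with P j, d j < N * {j ∈ Finset.univ.filter (fun j => y j = 1) | P j}.card + N := by
    intro P _ h
    have hcard : ∑ j with P j, (y j : ℚ) =
        {j ∈ Finset.univ.filter (fun j => y j = 1) | P j}.card := by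
      rw [Finset.filter_comm, Finset.card_filter]
      push_cast
      refine Finset.sum_congr rfl fun j _ => ?_
      by_cases h1 : y j = 1
      · simp [h1]
      · have h0 := h01 j
        rw [if_neg h1] at h0
        simp [h0]
    rw [hcard, ← Finset.sum_div, abs_lt] at h
    obtain ⟨h1, h2⟩ := h
    rw [lt_sub_iff_add_lt, neg_add_eq_sub, sub_lt_iff_lt_add, div_lt_iff₀ hN'] at h1
    rw [sub_lt_iff_lt_add, ← sub_lt_iff_lt_add', lt_div_iff₀ hN'] at h2
    constructor
    · have : (N : ℚ) * ({j ∈ Finset.univ.filter (fun j => y j = 1) | P j}.card : ℚ) <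
        ∑ j with P j, (d j : ℚ) + N := by linarith
      exact_mod_cast this
    · have : ∑ j with P j, (d j : ℚ) <
        (N : ℚ) * ({j ∈ Finset.univ.filter (fun j => y j = 1) | P j}.card : ℚ) + N := by linarith
      exact_mod_cast this
  refine ⟨Finset.univ.filter fun j => y j = 1, fun j hj => ?_, fun a => near _ (hA a),
    fun b => near _ (hB b), fun c => near _ (hC c), fun e => ?_⟩
  · by_contra h0
    have h0' : d j = 0 := by omega
    have h := hy j
    rw [(Finset.mem_filter.1 hj).2, h0'] at h
    norm_num at h
  · by_cases he : e ∈ Set.range g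
    · have := near (fun j => g j = e) (by simpa [Subtype.ext_iff] using hD ⟨e, he⟩)
      exact this
    · have hne : ∀ j, g j ≠ e := fun j h => he ⟨j, h⟩
      simp [hne, hN]

/-! ### Merging labels: remaining weight and number of labels -/

theorem sum_filter_label {J : Type*} [Fintype J] [DecidableEq J] (κ : J → J) (Q : J → Prop)
    [DecidablePred Q] (d : J → ℕ) :
    ∑ j with Q (κ j), d j = ∑ a ∈ (Finset.univ.image κ).filter Q, ∑ j with κ j = a, d j := by
  rw [← Finset.sum_fiberwise_of_maps_to (s := Finset.univ.filter fun j => Q (κ j))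
    (t := (Finset.univ.image κ).filter Q) (g := κ)]
  · refine Finset.sum_congr rfl fun a ha => ?_
    refine Finset.sum_congr ?_ fun _ _ => rfl
    ext j
    simp only [Finset.mem_filter, Finset.mem_univ, true_and]
    constructor
    · exact fun h => h.2
    · rintro rfl
      exact ⟨(Finset.mem_filter.1 ha).2, rfl⟩
  · intro j hj
    simp only [Finset.mem_filter, Finset.mem_univ, true_and, Finset.mem_image] at hj ⊢
    exact ⟨⟨j, rfl⟩, hj⟩

/-- Merging, in every color, all the labels that occur on `Y` to the label of `ρ i`. -/
def mergeLabel {I J : Type*} [DecidableEq J] (col : J → I) (κ : J → J) (Y : Finset J)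
    (ρ : I → J) (j : J) : J :=
  if κ j ∈ Y.image κ then κ (ρ (col j)) else κ j

section mergeLabel

variable {I J : Type*} [DecidableEq J] {col : J → I} {κ : J → J}
  {Y : Finset J} {ρ : I → J}

theorem col_mergeLabel (hcol : ∀ j, col (κ j) = col j)
    (hρ : ∀ i, ρ i ∈ Y ∧ col (ρ i) = i) (j : J) : col (mergeLabel col κ Y ρ j) = col j := by
  unfold mergeLabel
  split_ifs
  · rw [hcol, (hρ _).2]
  · exact hcol j

theorem mergeLabel_eq_iff_of_notMem (hρ : ∀ i, ρ i ∈ Y ∧ col (ρ i) = i) {j j' : J}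
    (hj : κ j ∉ Y.image κ) :
    mergeLabel col κ Y ρ j' = mergeLabel col κ Y ρ j ↔ κ j' = κ j := by
  unfold mergeLabel
  rw [if_neg hj]
  split_ifs with h
  · constructor
    · intro h'
      exact absurd (h' ▸ Finset.mem_image_of_mem κ (hρ (col j')).1) hj
    · intro h'
      exact absurd (h' ▸ h) hj
  · rfl

theorem mergeLabel_eq_of_label_eq {j j' : J} (hcol : ∀ j, col (κ j) = col j) (h : κ j = κ j') :
    mergeLabel col κ Y ρ j = mergeLabel col κ Y ρ j' := by
  have : col j = col j' := by rw [← hcol j, h, hcol]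
  unfold mergeLabel
  rw [h, this]

theorem mergeLabel_eq_of_mem {j j' : J} (hj : κ j ∈ Y.image κ) (hj' : κ j' ∈ Y.image κ)
    (h : col j = col j') :
    mergeLabel col κ Y ρ j = mergeLabel col κ Y ρ j' := by
  unfold mergeLabel
  rw [if_pos hj, if_pos hj', h]

variable [Fintype J] [DecidableEq I]

theorem sum_sub_add_card {d : J → ℕ} (hY : ∀ j ∈ Y, 1 ≤ d j) (P : J → Prop) [DecidablePred P] :
    ∑ j with P j, (d j - if j ∈ Y then 1 else 0) + {j ∈ Y | P j}.card = ∑ j with P j, d j := by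
  have : {j ∈ Y | P j}.card = ∑ j with P j, if j ∈ Y then 1 else 0 := by
    rw [Finset.sum_ite_mem, Finset.sum_const, smul_eq_mul, mul_one]
    congr 1
    ext j
    simp [and_comm]
  rw [this, ← Finset.sum_add_distrib]
  refine Finset.sum_congr rfl fun j _ => ?_
  split_ifs with h
  · have := hY j h
    omega
  · rfl

/-- In a color with few labels, the labels of weight at least two have total weight at
least `N + 1`. -/
theorem le_sum_heavy {d : J → ℕ} {r N : ℕ} (hN : 0 < N) (hcol : ∀ j, col (κ j) = col j) (i : I)
    (hsum : ∑ j with col j = i, d j = r * (N + 1))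
    (hcard : ((Finset.univ.image κ).filter fun a => col a = i).card + (N + 1) ≤ r * (N + 1) + 1) :
    N + 1 ≤ ∑ j with col j = i ∧ 2 ≤ ∑ j' with κ j' = κ j, d j', d j := by
  set D : J → ℕ := fun a => ∑ j with κ j = a, d j with hD
  have h1 := sum_filter_label κ (fun a => col a = i) d
  have h2 := sum_filter_label κ (fun a => col a = i ∧ 2 ≤ D a) d
  simp only [hcol] at h1 h2
  rw [hsum] at h1
  change N + 1 ≤ ∑ j with col j = i ∧ 2 ≤ D (κ j), d j
  change _ = ∑ a ∈ (Finset.univ.image κ).filter (fun a => col a = i), D a at h1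
  change _ = ∑ a ∈ (Finset.univ.image κ).filter (fun a => col a = i ∧ 2 ≤ D a), D a at h2
  rw [h2, ← Finset.filter_filter]
  set K := (Finset.univ.image κ).filter fun a => col a = i with hK
  have hsplit := Finset.sum_filter_add_sum_filter_not K (fun a => 2 ≤ D a) D
  have hsplit' := Finset.card_filter_add_card_filter_not (s := K) (fun a => 2 ≤ D a)
  have hle : ∑ a ∈ K.filter (fun a => ¬ 2 ≤ D a), D a ≤
      (K.filter fun a => ¬ 2 ≤ D a).card := by
    rw [Finset.card_eq_sum_ones]
    refine Finset.sum_le_sum fun a ha => ?_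
    have := (Finset.mem_filter.1 ha).2
    omega
  -- Light labels weigh at most their number, so the heavy ones weigh at least `N` plus their
  -- number. Having none would put the whole weight `r * (N + 1)` on at most `r * (N + 1) - N`
  -- labels, impossible as `N > 0`.
  rcases (K.filter fun a => 2 ≤ D a).eq_empty_or_nonempty with he | he
  · rw [he] at hsplit hsplit'
    simp only [Finset.sum_empty, Finset.card_empty, zero_add] at hsplit hsplit'
    omega
  · have := he.card_pos
    omega

/-- After removing a balanced set `Y` and merging the labels on `Y`, every label still has
positive weight. -/
theorem one_le_sum_mergeLabel {d : J → ℕ} {r N : ℕ} (hN : 0 < N)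
    (hcol : ∀ j, col (κ j) = col j) (hρ : ∀ i, ρ i ∈ Y ∧ col (ρ i) = i) (hY : ∀ j ∈ Y, 1 ≤ d j)
    (hsum : ∀ i, ∑ j with col j = i, d j = r * (N + 1))
    (hpos : ∀ j, 1 ≤ ∑ j' with κ j' = κ j, d j')
    (hcard : ∀ i,
      ((Finset.univ.image κ).filter fun a => col a = i).card + (N + 1) ≤ r * (N + 1) + 1)
    (hlabel : ∀ a, (N + 1) * {j ∈ Y | κ j = a}.card < ∑ j with κ j = a, d j + (N + 1))
    (hheavy : ∀ i, ∑ j with col j = i ∧ 2 ≤ ∑ j' with κ j' = κ j, d j', d j <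
      (N + 1) * {j ∈ Y | col j = i ∧ 2 ≤ ∑ j' with κ j' = κ j, d j'}.card + (N + 1)) (j : J) :
    1 ≤ ∑ j' with mergeLabel col κ Y ρ j' = mergeLabel col κ Y ρ j,
      (d j' - if j' ∈ Y then 1 else 0) := by
  by_cases hj : κ j ∈ Y.image κ
  · have h1 := le_sum_heavy hN hcol (col j) (hsum _) (hcard _)
    have h2 := hheavy (col j)
    have h3 : 0 < {j' ∈ Y | col j' = col j ∧ 2 ≤ ∑ j'' with κ j'' = κ j', d j''}.card := by
      by_contra h0
      rw [Nat.eq_zero_of_not_pos h0] at h2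
      omega
    obtain ⟨y, hy⟩ := Finset.card_pos.1 h3
    obtain ⟨hyY, hyc, hyD⟩ := Finset.mem_filter.1 hy
    have h4 := sum_sub_add_card hY (fun j' => κ j' = κ y)
    have h5 := hlabel (κ y)
    have h6 : ∑ j' with κ j' = κ y, (d j' - if j' ∈ Y then 1 else 0) ≤
        ∑ j' with mergeLabel col κ Y ρ j' = mergeLabel col κ Y ρ j,
          (d j' - if j' ∈ Y then 1 else 0) := by
      refine Finset.sum_le_sum_of_subset fun j' hj' => ?_
      simp only [Finset.mem_filter, Finset.mem_univ, true_and] at hj' ⊢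
      rw [mergeLabel_eq_of_label_eq hcol hj',
        mergeLabel_eq_of_mem (Finset.mem_image_of_mem κ hyY) hj hyc]
    -- If `Y` used up the whole weight `D ≥ 2` of the label of `y`, balance would give `(N + 1) * D
    -- < D + (N + 1)`, hence `N < 1`.
    refine le_trans ?_ h6
    by_contra h0
    have h7 : {j' ∈ Y | κ j' = κ y}.card = ∑ j' with κ j' = κ y, d j' := by omega
    rw [h7] at h5
    nlinarith
  · refine (hpos j).trans (le_of_eq ?_)
    refine Finset.sum_congr ?_ fun j' hj' => ?_
    · ext j'
      simp [mergeLabel_eq_iff_of_notMem hρ hj]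
    · have h1 : mergeLabel col κ Y ρ j' = mergeLabel col κ Y ρ j := by
        simpa using hj'
      have h2 : j' ∉ Y := by
        intro h
        apply hj
        rw [← (mergeLabel_eq_iff_of_notMem hρ hj).1 h1]
        exact Finset.mem_image_of_mem κ h
      simp [h2]

/-- After removing a balanced set `Y` and merging the labels on `Y`, every color still has
few labels. -/
theorem card_mergeLabel_add_le {d : J → ℕ} {r N : ℕ}
    (hcol : ∀ j, col (κ j) = col j) (hρ : ∀ i, ρ i ∈ Y ∧ col (ρ i) = i) (hY : ∀ j ∈ Y, 1 ≤ d j)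
    (hsum : ∀ i, ∑ j with col j = i, d j = r * (N + 1))
    (hpos : ∀ j, 1 ≤ ∑ j' with κ j' = κ j, d j')
    (hcard : ∀ i,
      ((Finset.univ.image κ).filter fun a => col a = i).card + (N + 1) ≤ r * (N + 1) + 1)
    (hYcol : ∀ i, {j ∈ Y | col j = i}.card = r)
    (hlabel : ∀ a, (N + 1) * {j ∈ Y | κ j = a}.card < ∑ j with κ j = a, d j + (N + 1) ∧
      ∑ j with κ j = a, d j < (N + 1) * {j ∈ Y | κ j = a}.card + (N + 1))
    (hpos' : 0 < N → ∀ j, 1 ≤ ∑ j' with mergeLabel col κ Y ρ j' = mergeLabel col κ Y ρ j,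
      (d j' - if j' ∈ Y then 1 else 0)) (i : I) :
    ((Finset.univ.image (mergeLabel col κ Y ρ)).filter fun a => col a = i).card + N ≤
      r * N + 1 := by
  set κ' := mergeLabel col κ Y ρ with hκ'
  have hcol' : ∀ j, col (κ' j) = col j := col_mergeLabel hcol hρ
  set K := (Finset.univ.image κ).filter fun a => col a = i with hK
  set t := (Y.filter fun j => col j = i).image κ with ht
  have htK : t ⊆ K := by
    intro a ha
    obtain ⟨j, hj, rfl⟩ := Finset.mem_image.1 ha
    simp only [hK, Finset.mem_filter, Finset.mem_image, Finset.mem_univ, true_and]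
    exact ⟨⟨j, rfl⟩, by rw [hcol, (Finset.mem_filter.1 hj).2]⟩
  have hsub : (Finset.univ.image κ').filter (fun a => col a = i) ⊆
      insert (κ (ρ i)) (K \ t) := by
    intro a ha
    simp only [Finset.mem_filter, Finset.mem_image, Finset.mem_univ, true_and] at ha
    obtain ⟨⟨j, rfl⟩, hj⟩ := ha
    rw [hcol'] at hj
    by_cases hm : κ j ∈ Y.image κ
    · simp [hκ', mergeLabel, hm, hj]
    · have h1 : κ' j = κ j := by simp only [hκ', mergeLabel, if_neg hm]
      rw [h1]
      refine Finset.mem_insert_of_mem (Finset.mem_sdiff.2 ⟨?_, ?_⟩)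
      · simp [hK, hcol, hj]
      · exact fun h => hm (Finset.image_subset_image (Finset.filter_subset _ _) h)
  have hle : ((Finset.univ.image κ').filter fun a => col a = i).card + t.card ≤ K.card + 1 := by
    have h1 := (Finset.card_le_card hsub).trans (Finset.card_insert_le _ _)
    rw [Finset.card_sdiff_of_subset htK] at h1
    have := Finset.card_le_card htK
    omega
  have hKc : K.card + (N + 1) ≤ r * (N + 1) + 1 := hcard i
  rcases Nat.eq_zero_or_pos N with rfl | hN
  -- With one vertex missing the rounding is exact, so `Y` meets every label and all labels of the
  -- colour merge.
  · have : K ⊆ t := by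
      intro a ha
      simp only [hK, Finset.mem_filter, Finset.mem_image, Finset.mem_univ, true_and] at ha
      obtain ⟨⟨j, rfl⟩, hj⟩ := ha
      have h1 := hpos j
      have h2 := (hlabel (κ j)).2
      obtain ⟨y, hy⟩ := Finset.card_pos.1 (show 0 < {j' ∈ Y | κ j' = κ j}.card by omega)
      obtain ⟨hyY, hyk⟩ := Finset.mem_filter.1 hy
      refine Finset.mem_image.2 ⟨y, Finset.mem_filter.2 ⟨hyY, ?_⟩, hyk⟩
      rw [← hcol y, hyk, hj]
    have := Finset.card_le_card this
    omega
  -- If the `r` items of `Y` in this colour have distinct labels, merging removes `r - 1` labels,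
  -- which is the drop required. Otherwise some label meets `Y` twice and keeps weight at least `N`;
  -- the other labels weigh at least 1 each out of a total of `r * N`.
  by_cases hinj : Set.InjOn κ (Y.filter fun j => col j = i)
  · have h1 : t.card = r := by rw [ht, Finset.card_image_of_injOn hinj, hYcol]
    have h2 : r * (N + 1) = r * N + r := by ring
    omega
  · simp only [Set.InjOn, Finset.coe_filter, Set.mem_ofPred_eq, not_forall] at hinj
    obtain ⟨y₁, ⟨hy₁, hc₁⟩, y₂, ⟨hy₂, hc₂⟩, hyk, hne⟩ := hinj
    have h2 : 2 ≤ {j ∈ Y | κ j = κ y₁}.card := by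
      rw [← Finset.card_pair hne]
      refine Finset.card_le_card fun y hy => ?_
      rcases Finset.mem_insert.1 hy with rfl | hy
      · simp [hy₁]
      · rw [Finset.mem_singleton.1 hy]
        simp [hy₂, hyk]
    obtain ⟨h3, -⟩ := hlabel (κ y₁)
    have h4 := sum_sub_add_card hY (fun j => κ j = κ y₁)
    have h5 : N ≤ ∑ j with κ j = κ y₁, (d j - if j ∈ Y then 1 else 0) := by
      by_contra h0
      have h6 : ∑ j with κ j = κ y₁, d j + 1 ≤ {j ∈ Y | κ j = κ y₁}.card + N := by omega
      nlinarith
    have h6 : ∑ j with κ j = κ y₁, (d j - if j ∈ Y then 1 else 0) ≤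
        ∑ j with κ' j = κ' y₁, (d j - if j ∈ Y then 1 else 0) := by
      refine Finset.sum_le_sum_of_subset fun j hj => ?_
      simp only [Finset.mem_filter, Finset.mem_univ, true_and] at hj ⊢
      exact mergeLabel_eq_of_label_eq hcol hj
    have h7 := sum_filter_label κ' (fun a => col a = i) (fun j => d j - if j ∈ Y then 1 else 0)
    simp only [hcol'] at h7
    have h8 := sum_sub_add_card hY (fun j => col j = i)
    rw [hsum, hYcol, h7] at h8
    have hmem : κ' y₁ ∈ (Finset.univ.image κ').filter (fun a => col a = i) := by
      simp [hcol', hc₁]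
    rw [← Finset.add_sum_erase _ _ hmem] at h8
    have h9 : (((Finset.univ.image κ').filter fun a => col a = i).erase (κ' y₁)).card ≤
        ∑ a ∈ ((Finset.univ.image κ').filter fun a => col a = i).erase (κ' y₁),
          ∑ j with κ' j = a, (d j - if j ∈ Y then 1 else 0) := by
      rw [Finset.card_eq_sum_ones]
      refine Finset.sum_le_sum fun a ha => ?_
      obtain ⟨j, -, rfl⟩ := Finset.mem_image.1 (Finset.mem_filter.1 (Finset.mem_erase.1 ha).2).1
      exact hpos' hN j
    rw [Finset.card_erase_of_mem hmem] at h9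
    have h10 : r * (N + 1) = r * N + r := by ring
    omega

end mergeLabel

/-! ### Partial factorizations and the addition of a vertex -/

/-- The partial factorizations of Baranyai's induction.  The items `j` are the future edges, `col`
assigns them to factors, and `S j` is the trace of the edge `j` on the vertex set `T`; `N` is the
number of vertices that are still missing. -/
structure IsPartialFactorization {α I J : Type*} [DecidableEq α] [Fintype J] [DecidableEq I]
    (r h N : ℕ) (col : J → I) (T : Finset α) (S : J → Finset α) : Prop where
  subset : ∀ j, S j ⊆ T
  card_le : ∀ j, (S j).card ≤ h
  card_eq : ∀ A ⊆ T, A.card ≤ h →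
    (Finset.univ.filter fun j => S j = A).card = N.choose (h - A.card)
  degree_eq : ∀ i, ∀ v ∈ T, (Finset.univ.filter fun j => col j = i ∧ v ∈ S j).card = r
  sum_eq : ∀ i, ∑ j with col j = i, (h - (S j).card) = r * N

/-- Two items of the same color are linked if their traces share a vertex. -/
def Linked {α I J : Type*} (col : J → I) (S : J → Finset α) (j j' : J) : Prop :=
  col j = col j' ∧ ∃ v, v ∈ S j ∧ v ∈ S j'

/-- A labelling of the items witnessing that every factor can still become connected: items of
equal label are joined by a chain of linked items, each label has a missing vertex, and there are
few labels in each color. -/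
structure IsComponentLabel {α I J : Type*} [DecidableEq I] [DecidableEq J] [Fintype J]
    (r h N : ℕ) (col : J → I) (S : J → Finset α) (κ : J → J) : Prop where
  col_eq : ∀ j, col (κ j) = col j
  chain : ∀ j j', κ j = κ j' → Relation.ReflTransGen (Linked col S) j j'
  one_le_sum : 0 < N → ∀ j, 1 ≤ ∑ j' with κ j' = κ j, (h - (S j').card)
  card_le : ∀ i, ((Finset.univ.image κ).filter fun a => col a = i).card + N ≤ r * N + 1

theorem card_insertOn {α J : Type*} [DecidableEq α] [DecidableEq J] {S : J → Finset α} {v : α}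
    (hS : ∀ j, v ∉ S j) (Y : Finset J) (j : J) :
    (if j ∈ Y then insert v (S j) else S j).card = (S j).card + if j ∈ Y then 1 else 0 := by
  split_ifs
  · exact Finset.card_insert_of_notMem (hS j)
  · rfl

/-- The trace of `j` does occur, so the binomial coefficient counting its occurrences is nonzero.
This bounds the weights to be rounded by 1. -/
theorem IsPartialFactorization.missing_le {α I J : Type*} [DecidableEq α] [DecidableEq I] [Fintype J]
    {r h N : ℕ} {col : J → I} {T : Finset α} {S : J → Finset α}
    (hS : IsPartialFactorization r h N col T S) (j : J) :
    h - (S j).card ≤ N := by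
  have h1 := hS.card_eq (S j) (hS.subset j) (hS.card_le j)
  by_contra hlt
  rw [Nat.choose_eq_zero_of_lt (not_le.1 hlt), Finset.card_eq_zero] at h1
  have : j ∈ Finset.univ.filter fun j' => S j' = S j := by simp
  rw [h1] at this
  simp at this

section step

variable {α I J : Type*} [DecidableEq α] [DecidableEq I] [Fintype J] [DecidableEq J]
  {r h N : ℕ} {col : J → I} {T : Finset α} {S : J → Finset α} {κ : J → J} {v : α}

/-- Adding the vertex `v` to a balanced set `Y` of items. -/
theorem IsPartialFactorization.insertOn (hS : IsPartialFactorization r h (N + 1) col T S)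
    (hv : v ∉ T) {Y : Finset J} (hY : ∀ j ∈ Y, 1 ≤ h - (S j).card)
    (hYcol : ∀ i, {j ∈ Y | col j = i}.card = r)
    (hYS : ∀ A, (N + 1) * {j ∈ Y | S j = A}.card < ∑ j with S j = A, (h - (S j).card) + (N + 1) ∧
      ∑ j with S j = A, (h - (S j).card) < (N + 1) * {j ∈ Y | S j = A}.card + (N + 1)) :
    IsPartialFactorization r h N col (insert v T)
      (fun j => if j ∈ Y then insert v (S j) else S j) := by
  have hvS : ∀ j, v ∉ S j := fun j hj => hv (hS.subset j hj)
  -- The total weight over a trace is `(N + 1) * N.choose (h - A.card - 1)` by the absorption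
  -- identity; being a multiple of `N + 1`, it is rounded without error.
  have hYA : ∀ A ⊆ T, A.card < h →
      {j ∈ Y | S j = A}.card = N.choose (h - A.card - 1) := by
    intro A hA hAh
    have h1 : ∑ j with S j = A, (h - (S j).card) = (N + 1) * N.choose (h - A.card - 1) := by
      have h2 : ∑ j with S j = A, (h - (S j).card) = ∑ j with S j = A, (h - A.card) :=
        Finset.sum_congr rfl fun j hj => by rw [(Finset.mem_filter.1 hj).2]
      rw [h2, Finset.sum_const, hS.card_eq A hA hAh.le, smul_eq_mul]
      obtain ⟨k, hk⟩ : ∃ k, h - A.card = k + 1 := ⟨h - A.card - 1, by omega⟩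
      rw [hk, Nat.add_sub_cancel, Nat.add_one_mul_choose_eq]
    have h3 := hYS A
    rw [h1] at h3
    obtain ⟨h4, h5⟩ := h3
    rw [← Nat.mul_succ] at h4 h5
    have h6 := Nat.lt_of_mul_lt_mul_left h4
    have h7 := Nat.lt_of_mul_lt_mul_left h5
    omega
  have hYh : ∀ A, h ≤ A.card → {j ∈ Y | S j = A}.card = 0 := by
    intro A hA
    rw [Finset.card_eq_zero, Finset.filter_eq_empty_iff]
    intro j hj hjA
    have := hY j hj
    rw [hjA] at this
    omega
  refine ⟨fun j => ?_, fun j => ?_, fun A hA hAh => ?_, fun i w hw => ?_, fun i => ?_⟩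
  · split_ifs
    · exact Finset.insert_subset_insert v (hS.subset j)
    · exact (hS.subset j).trans (Finset.subset_insert v T)
  · rw [card_insertOn hvS]
    have h1 := hS.card_le j
    split_ifs with hj
    · have := hY j hj
      omega
    · omega
  · by_cases hvA : v ∈ A
    · have h1 : (Finset.univ.filter fun j => (if j ∈ Y then insert v (S j) else S j) = A) =
          {j ∈ Y | S j = A.erase v} := by
        ext j
        simp only [Finset.mem_filter, Finset.mem_univ, true_and]
        split_ifs with hj
        · simp only [hj, true_and]
          constructor
          · rintro rfl
            rw [Finset.erase_insert (hvS j)]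
          · intro h'
            rw [h', Finset.insert_erase hvA]
        · simp only [hj, false_and, iff_false]
          rintro rfl
          exact hvS j hvA
      have h2 := Finset.card_erase_add_one hvA
      rw [h1, hYA _ (by rwa [← Finset.subset_insert_iff]) (by omega)]
      congr 1
      omega
    · have hAT : A ⊆ T := (Finset.subset_insert_iff_of_notMem hvA).1 hA
      have h1 : (Finset.univ.filter fun j => (if j ∈ Y then insert v (S j) else S j) = A) =
          (Finset.univ.filter fun j => S j = A) \ {j ∈ Y | S j = A} := by
        ext j
        simp only [Finset.mem_filter, Finset.mem_univ, true_and, Finset.mem_sdiff, not_and]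
        split_ifs with hj
        · simp only [hj, true_implies]
          constructor
          · rintro rfl
            exact absurd (Finset.mem_insert_self _ _) hvA
          · exact fun h' => absurd h'.1 h'.2
        · simp [hj]
      rw [h1, Finset.card_sdiff_of_subset
        (Finset.filter_subset_filter _ (Finset.subset_univ Y)), hS.card_eq A hAT hAh]
      rcases hAh.lt_or_eq with hlt | heq
      · rw [hYA A hAT hlt]
        obtain ⟨k, hk⟩ : ∃ k, h - A.card = k + 1 := ⟨h - A.card - 1, by omega⟩
        rw [hk, Nat.add_sub_cancel, Nat.choose_succ_succ, Nat.add_sub_cancel_left]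
      · rw [hYh A heq.ge, heq]
        simp
  · rcases Finset.mem_insert.1 hw with rfl | hwT
    · rw [← hYcol i]
      congr 1
      ext j
      simp only [Finset.mem_filter, Finset.mem_univ, true_and]
      split_ifs with hj
      · simp [hj]
      · simp [hj, hvS j]
    · have hwv : w ≠ v := fun h' => hv (h' ▸ hwT)
      rw [← hS.degree_eq i w hwT]
      congr 1
      ext j
      simp only [Finset.mem_filter, Finset.mem_univ, true_and]
      split_ifs <;> simp [hwv]
  · have h1 := sum_sub_add_card hY (fun j => col j = i)
    rw [hS.sum_eq, hYcol] at h1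
    simp only [card_insertOn hvS, ← Nat.sub_sub]
    rw [mul_add_one] at h1
    omega

/-- One step of the induction: the vertex `v` is added to the partial factorization, and a
component labelling is updated. -/
theorem IsPartialFactorization.exists_insert [Fintype I]
    (hS : IsPartialFactorization r h (N + 1) col T S)
    (hr : 0 < r) (hv : v ∉ T) (hκ : ∀ j, col (κ j) = col j) :
    ∃ S' : J → Finset α, ∃ κ' : J → J, IsPartialFactorization r h N col (insert v T) S' ∧
      (∀ j, col (κ' j) = col j) ∧
      (IsComponentLabel r h (N + 1) col S κ → IsComponentLabel r h N col S' κ') := by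
  have hvS : ∀ j, v ∉ S j := fun j hj => hv (hS.subset j hj)
  -- The chain of partitions is: labels, then colour together with whether the label is heavy, then
  -- colours. Traces are the independent partition.
  obtain ⟨Y, hY, hlabel, hheavy, hYcol, hYS⟩ := exists_rounding_finset κ
    (fun a => (col a, decide (2 ≤ ∑ j with κ j = a, (h - (S j).card)))) Prod.fst S
    (fun j => h - (S j).card) (N + 1) N.succ_pos hS.missing_le
  have hYcol' : ∀ i, {j ∈ Y | col j = i}.card = r := by
    intro i
    have h1 := hYcol i
    simp only [hκ] at h1
    rw [hS.sum_eq, mul_comm r, ← Nat.mul_succ, ← Nat.mul_succ] at h1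
    have h2 := Nat.lt_of_mul_lt_mul_left h1.1
    have h3 := Nat.lt_of_mul_lt_mul_left h1.2
    omega
  have hheavy' : ∀ i,
      ∑ j with col j = i ∧ 2 ≤ ∑ j' with κ j' = κ j, (h - (S j').card), (h - (S j).card) <
      (N + 1) * {j ∈ Y | col j = i ∧ 2 ≤ ∑ j' with κ j' = κ j, (h - (S j').card)}.card +
        (N + 1) := by
    intro i
    have h1 := (hheavy (i, true)).2
    simpa only [Prod.mk.injEq, decide_eq_true_eq, hκ] using h1
  have hex : ∀ i, ∃ j, j ∈ Y ∧ col j = i := by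
    intro i
    obtain ⟨j, hj⟩ := Finset.card_pos.1 (hr.trans_eq (hYcol' i).symm)
    exact ⟨j, Finset.mem_filter.1 hj⟩
  choose ρ hρ using hex
  refine ⟨fun j => if j ∈ Y then insert v (S j) else S j, mergeLabel col κ Y ρ,
    hS.insertOn hv hY hYcol' hYS, col_mergeLabel hκ hρ, fun hc => ?_⟩
  have hpos : ∀ j, 1 ≤ ∑ j' with κ j' = κ j, (h - (S j').card) := hc.one_le_sum N.succ_pos
  have hpos' := fun hN : 0 < N => one_le_sum_mergeLabel hN hκ hρ hY hS.sum_eq hpos hc.card_le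
    (fun a => (hlabel a).1) hheavy'
  refine ⟨col_mergeLabel hκ hρ, fun j j' hjj' => ?_, fun hN j => ?_,
    card_mergeLabel_add_le hκ hρ hY hS.sum_eq hpos hc.card_le hYcol' hlabel hpos'⟩
  · have hmono : ∀ j j', κ j = κ j' → Relation.ReflTransGen
        (Linked col fun j => if j ∈ Y then insert v (S j) else S j) j j' := by
      intro j j' hjj'
      have hsub : ∀ j, S j ⊆ if j ∈ Y then insert v (S j) else S j := by
        intro j
        split_ifs
        · exact Finset.subset_insert _ _
        · exact subset_rfl
      have hle : ∀ a b, Linked col S a b →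
          Linked col (fun j => if j ∈ Y then insert v (S j) else S j) a b := by
        rintro a b ⟨hab, w, hwa, hwb⟩
        exact ⟨hab, w, hsub a hwa, hsub b hwb⟩
      exact Relation.ReflTransGen.mono hle _ _ (hc.chain j j' hjj')
    by_cases hj : κ j ∈ Y.image κ
    · by_cases hj' : κ j' ∈ Y.image κ
      · obtain ⟨y, hy, hyj⟩ := Finset.mem_image.1 hj
        obtain ⟨y', hy', hyj'⟩ := Finset.mem_image.1 hj'
        -- Two merged labels are bridged by `y` and `y'`, which both receive `v`.
        refine (hmono j y hyj.symm).trans (Relation.ReflTransGen.head ⟨?_, v, ?_, ?_⟩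
          (hmono y' j' hyj'))
        · rw [← hκ y, ← hκ y', hyj, hyj', hκ, hκ, ← col_mergeLabel hκ hρ j, hjj',
            col_mergeLabel hκ hρ]
        · simp [hy]
        · simp [hy']
      · exact absurd ((mergeLabel_eq_iff_of_notMem hρ hj').1 hjj' ▸ hj) hj'
    · exact hmono j j' ((mergeLabel_eq_iff_of_notMem hρ hj).1 hjj'.symm).symm
  · simp only [card_insertOn hvS, ← Nat.sub_sub]
    exact hpos' hN j

/-- Adding all the vertices of `U` one by one. -/
theorem IsPartialFactorization.exists_union [Fintype I] (hr : 0 < r) (U : Finset α) {T : Finset α}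
    {S : J → Finset α} {κ : J → J} (hS : IsPartialFactorization r h U.card col T S)
    (hU : Disjoint T U) (hκ : ∀ j, col (κ j) = col j) :
    ∃ S' : J → Finset α, ∃ κ' : J → J, IsPartialFactorization r h 0 col (T ∪ U) S' ∧
      (IsComponentLabel r h U.card col S κ → IsComponentLabel r h 0 col S' κ') := by
  induction U using Finset.induction_on generalizing T S κ with
  | empty => exact ⟨S, κ, by simpa using hS, fun h => by simpa using h⟩
  | insert v U hvU ih =>
    rw [Finset.card_insert_of_notMem hvU] at hS ⊢
    rw [Finset.disjoint_insert_right] at hU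
    obtain ⟨S₁, κ₁, hS₁, hκ₁, hc₁⟩ := hS.exists_insert hr hU.1 hκ
    obtain ⟨S', κ', hS', hc'⟩ := ih hS₁ (Finset.disjoint_insert_left.2 ⟨hvU, hU.2⟩) hκ₁
    refine ⟨S', κ', ?_, fun h => hc' (hc₁ h)⟩
    rwa [Finset.insert_union, ← Finset.union_insert] at hS'

end step

/-! ### The initial state and the number of factors -/

theorem isPartialFactorization_empty {α : Type*} [DecidableEq α] {k m n h r : ℕ}
    (hk : k * m = n.choose h) (hm : m * h = r * n) :
    IsPartialFactorization r h n (fun j : Fin k × Fin m => j.1) ∅ (fun _ => (∅ : Finset α)) := by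
  refine ⟨fun j => subset_rfl, fun j => by simp, fun A hA _ => ?_, fun i v hv => by simp at hv,
    fun i => ?_⟩
  · obtain rfl := Finset.subset_empty.1 hA
    simp [hk]
  · have h1 : (Finset.univ.filter fun j : Fin k × Fin m => j.1 = i) =
        ({i} : Finset (Fin k)) ×ˢ (Finset.univ : Finset (Fin m)) := by
      ext ⟨a, b⟩
      simp [eq_comm]
    rw [Finset.sum_const, h1, Finset.card_product]
    simpa using hm

/-- Each item is its own label, so a colour has `m` labels. From `2 * m ≤ m * h = r * n` and `2 * n
≤ r * n` it follows that `m + n ≤ r * n`. -/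
theorem isComponentLabel_id {α : Type*} [DecidableEq α] {k m n h r : ℕ} (hh : 2 ≤ h) (hr : 2 ≤ r)
    (hm : m * h = r * n) :
    IsComponentLabel r h n (fun j : Fin k × Fin m => j.1) (fun _ => (∅ : Finset α)) id := by
  refine ⟨fun j => rfl, fun j j' hj => ?_, fun _ j => ?_, fun i => ?_⟩
  · rw [show j = j' from hj]
  · rw [Finset.sum_const, Finset.card_empty, smul_eq_mul]
    refine Nat.mul_pos (Finset.card_pos.2 ⟨j, by simp⟩) (by omega)
  · have h1 : ((Finset.univ.image id).filter fun j : Fin k × Fin m => j.1 = i) =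
        ({i} : Finset (Fin k)) ×ˢ (Finset.univ : Finset (Fin m)) := by
      ext ⟨a, b⟩
      simp [eq_comm]
    rw [h1, Finset.card_product]
    simp only [Finset.card_singleton, Finset.card_univ, Fintype.card_fin, one_mul]
    have h2 : m * 2 ≤ m * h := Nat.mul_le_mul_left m hh
    have h3 : 2 * n ≤ r * n := Nat.mul_le_mul_right n hr
    omega

/-- The number of edges of `K_n^h` is a multiple of the number of edges of an `r`-factor,
where `r = h / gcd(n, h)`. -/
theorem exists_mul_eq_choose {n h : ℕ} (hh : 1 ≤ h) (hn : h < n) :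
    ∃ k, k * (n / n.gcd h) = n.choose h := by
  obtain ⟨n', rfl⟩ : ∃ n', n = n' + 1 := ⟨n - 1, by omega⟩
  obtain ⟨h', rfl⟩ : ∃ h', h = h' + 1 := ⟨h - 1, by omega⟩
  have hg : 0 < (n' + 1).gcd (h' + 1) := Nat.gcd_pos_of_pos_left _ n'.succ_pos
  have h1 := Nat.add_one_mul_choose_eq n' h'
  have h2 := Nat.div_mul_cancel (Nat.gcd_dvd_left (n' + 1) (h' + 1))
  have h3 := Nat.div_mul_cancel (Nat.gcd_dvd_right (n' + 1) (h' + 1))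
  have hcop := Nat.coprime_div_gcd_div_gcd hg
  generalize (n' + 1).gcd (h' + 1) = g at *
  -- Dividing `n * (n - 1).choose (h - 1) = n.choose h * h` by the gcd leaves a factor `h / g`
  -- coprime to `n / g`.
  have h4 : (n' + 1) / g ∣ (n' + 1).choose (h' + 1) * ((h' + 1) / g) := by
    refine ⟨n'.choose h', Nat.eq_of_mul_eq_mul_right hg ?_⟩
    rw [mul_assoc, h3, ← h1, mul_right_comm, h2]
  obtain ⟨k, hk⟩ := hcop.dvd_of_dvd_mul_right h4
  exact ⟨k, by rw [hk, mul_comm]⟩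

/-! ### Reading off the factors when no vertex is missing -/

namespace MultiHypergraph

variable {α : Type*}

/-- The `i`-th factor read off from a family of traces. -/
def ofTraces {k m : ℕ} (V : Finset α) (S : Fin k × Fin m → Finset α) (hS : ∀ j, S j ⊆ V)
    (i : Fin k) : MultiHypergraph α where
  vertices := V
  edges := Finset.univ.val.map fun l : Fin m => (S (i, l)).val
  mem_vertices := by
    intro e he v hv
    obtain ⟨l, -, rfl⟩ := Multiset.mem_map.1 he
    exact hS _ hv

variable [DecidableEq α] {k m h r : ℕ} {V : Finset α} {S : Fin k × Fin m → Finset α}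

/-- With `N = 0` no incidence is missing, so every trace has `h` elements, and each `h`-subset
occurs `Nat.choose 0 0 = 1` time. -/
theorem map_traces_eq (hS : IsPartialFactorization r h 0 (fun j : Fin k × Fin m => j.1) V S) :
    (Finset.univ : Finset (Fin k × Fin m)).val.map S = (V.powersetCard h).val := by
  ext A
  rw [Multiset.count_map, Multiset.count_eq_of_nodup (V.powersetCard h).nodup]
  simp only [Finset.mem_val, Finset.mem_powersetCard]
  have h1 : (Multiset.filter (fun a => A = S a) Finset.univ.val).card =
      (Finset.univ.filter fun j => S j = A).card := by
    simp only [eq_comm (a := A)]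
    rfl
  rw [h1]
  have h2 : ∀ j, (S j).card = h := fun j => by
    have := hS.missing_le j
    have := hS.card_le j
    omega
  split_ifs with hA
  · rw [hS.card_eq A hA.1 hA.2.le, hA.2]
    simp
  · rw [Finset.card_eq_zero, Finset.filter_eq_empty_iff]
    rintro j - rfl
    exact hA ⟨hS.subset j, h2 j⟩

theorem isFactorization_ofTraces (hr : 0 < r)
    (hS : IsPartialFactorization r h 0 (fun j : Fin k × Fin m => j.1) V S) :
    (complete V h).IsFactorization (fun _ => r) (ofTraces V S hS.subset) := by
  have hsum : ∑ i, (ofTraces V S hS.subset i).edges = (complete V h).edges := by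
    simp only [ofTraces, complete, ← map_traces_eq hS, Multiset.map_map]
    rw [← Finset.univ_product_univ, Finset.product_val]
    simp only [SProd.sprod, Multiset.product, Multiset.map_bind, Multiset.map_map]
    rfl
  refine ⟨fun _ => hr, fun i => ⟨rfl, ?_, fun v hv => ?_⟩, hsum⟩
  · rw [← hsum]
    exact Finset.single_le_sum (f := fun i => (ofTraces V S hS.subset i).edges)
      (fun _ _ => Multiset.zero_le _) (Finset.mem_univ i)
  · refine Eq.trans ?_ (hS.degree_eq i v hv)
    rw [Finset.card_filter, Fintype.sum_prod_type, Finset.sum_eq_single i _ (by simp)]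
    · simp only [degree, ofTraces, Multiset.map_map, true_and]
      refine Finset.sum_congr rfl fun l _ => ?_
      exact Multiset.count_eq_of_nodup (S (i, l)).nodup
    · intro i' _ hi'
      simp [hi']

/-- At `N = 0` the bound on labels leaves at most one per colour, so any two edges of a factor are
joined by a chain of intersecting edges. Since `r > 0`, these edges cover `V`. -/
theorem isConnected_ofTraces (hr : 0 < r) (hV : V.Nonempty)
    (hS : IsPartialFactorization r h 0 (fun j : Fin k × Fin m => j.1) V S)
    {κ : Fin k × Fin m → Fin k × Fin m}
    (hκ : IsComponentLabel r h 0 (fun j : Fin k × Fin m => j.1) S κ) (i : Fin k) :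
    (ofTraces V S hS.subset i).IsConnected := by
  have hadj : ∀ j u v, j.1 = i → u ∈ S j → v ∈ S j → (ofTraces V S hS.subset i).Adj u v := by
    rintro ⟨i', l⟩ u v rfl hu hv
    exact ⟨(S (i', l)).val, Multiset.mem_map.2 ⟨l, Finset.mem_univ _, rfl⟩, hu, hv⟩
  have hcov : ∀ v ∈ V, ∃ j, j.1 = i ∧ v ∈ S j := by
    intro v hv
    obtain ⟨j, hj⟩ := Finset.card_pos.1 (hr.trans_eq (hS.degree_eq i v hv).symm)
    exact ⟨j, (Finset.mem_filter.1 hj).2⟩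
  have hlink : ∀ j j', Relation.ReflTransGen (Linked (fun j => j.1) S) j j' → j.1 = i →
      ∀ u ∈ S j, ∀ v ∈ S j', Relation.ReflTransGen (ofTraces V S hS.subset i).Adj u v := by
    intro j j' hjj'
    induction hjj' using Relation.ReflTransGen.head_induction_on with
    | refl => exact fun hj u hu v hv => .single (hadj _ u v hj hu hv)
    | head hab _ ih =>
      obtain ⟨hab, w, hwa, hwb⟩ := hab
      exact fun hj u hu v hv => .head (hadj _ u w hj hu hwa) (ih (hab.symm.trans hj) w hwb v hv)
  refine ⟨hV, fun u hu v hv => ?_⟩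
  obtain ⟨j, hj, huj⟩ := hcov u hu
  obtain ⟨j', hj', hvj⟩ := hcov v hv
  refine hlink j j' (hκ.chain j j' ?_) hj u huj v hvj
  have h1 := hκ.card_le i
  rw [mul_zero, zero_add, add_zero] at h1
  refine Finset.card_le_one.1 h1 _ ?_ _ ?_
  · have := hκ.col_eq j
    simpa [hj] using this
  · have := hκ.col_eq j'
    simpa [hj'] using this

end MultiHypergraph

theorem corollary5 {α : Type*} [DecidableEq α] (n h : ℕ) (hh : 1 ≤ h) (hn : h < n)
    (V : Finset α) (hV : V.card = n) :
    (MultiHypergraph.complete V h).HasFactorization (h / Nat.gcd n h) ∧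
      (¬ h ∣ n → (MultiHypergraph.complete V h).HasConnectedFactorization (h / Nat.gcd n h)) := by
  obtain ⟨k, hk⟩ := exists_mul_eq_choose hh hn
  have hg : 0 < n.gcd h := Nat.gcd_pos_of_pos_right _ hh
  have hr : 0 < h / n.gcd h := Nat.div_pos (Nat.le_of_dvd hh (Nat.gcd_dvd_right n h)) hg
  have hm : n / n.gcd h * h = h / n.gcd h * n := by
    have h2 := Nat.div_mul_cancel (Nat.gcd_dvd_left n h)
    have h3 := Nat.div_mul_cancel (Nat.gcd_dvd_right n h)
    calc n / n.gcd h * h = n / n.gcd h * (h / n.gcd h * n.gcd h) := by rw [h3]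
      _ = h / n.gcd h * (n / n.gcd h * n.gcd h) := by ring
      _ = h / n.gcd h * n := by rw [h2]
  have h0 : IsPartialFactorization (h / n.gcd h) h V.card
      (fun j : Fin k × Fin (n / n.gcd h) => j.1) ∅ (fun _ => (∅ : Finset α)) :=
    isPartialFactorization_empty (by rwa [hV]) (by rwa [hV])
  -- The same construction serves both claims: the labelling is always carried along, but its
  -- invariant is supplied only when `r ≥ 2`.
  obtain ⟨S, κ, hS, hκ⟩ := IsPartialFactorization.exists_union (κ := id) hr V
    h0 (Finset.disjoint_empty_left V) (fun _ => rfl)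
  rw [Finset.empty_union] at hS
  rw [hV] at hκ
  refine ⟨⟨k, _, MultiHypergraph.isFactorization_ofTraces hr hS⟩, fun hdvd => ?_⟩
  have hr2 : 2 ≤ h / n.gcd h := by
    by_contra hlt
    have h1 : h / n.gcd h = 1 := by omega
    have h2 := Nat.div_mul_cancel (Nat.gcd_dvd_right n h)
    rw [h1, one_mul] at h2
    exact hdvd (h2 ▸ Nat.gcd_dvd_left n h)
  have hh2 : 2 ≤ h := hr2.trans (Nat.div_le_self _ _)
  exact ⟨k, _, MultiHypergraph.isFactorization_ofTraces hr hS,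
    MultiHypergraph.isConnected_ofTraces hr (Finset.card_pos.1 (by omega)) hS
      (hκ (isComponentLabel_id hh2 hr2 hm))⟩
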